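/- Let $F$ be an imaginary cyclic sextic field (a totally complex Galois extension of $\mathbb{Q}$ of degree $6$ with cyclic Galois group, generated by $\tau$), with maximal real subfield $K$ and imaginary quadratic subfield $k=\mathbb{Q}(\sqrt{-d})$, where $d$ is a squarefree positive integer. Write $O_F, O_K, O_k$ for the rings of integers and $\mu_F$ for the set of roots of unity of $F$. Let $p$ be the conductor of the cyclic cubic field $K$, that is, the least positive integer $n$ such that $K$ embeds into $\mathbb{Q}(\zeta_n)$, and let $t=\gcd(p,d)$. View $F$ as a subfield of $\mathbb{C}$ and put $\|f\|^2 = 2\sum_{i=0}^{2}|\tau^i(f)|^2$ for $f\in F$. Assume that $d\equiv 3 \pmod 4$ and put $\delta=\frac{1+\sqrt{-d}}{2}$. Assume that there is an element $$f=\frac{1}{t}(\alpha+\beta\delta)\in O_F\setminus(O_K\cup O_k\cup\mu_F),\qquad \alpha,\beta\in O_K,\qquad \|f\|^2<22.$$ Then: (i) if $\beta\in O_K\setminus\mathbb{Z}$, then $p\le 61$ and $d\le 59$; (ii) if $\beta\in\mathbb{Z}\setminus\{0\}$, then $p\le 61$ and $d\le 11$. -/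

import Mathlib

open NumberField IntermediateField

/-- `p` is the conductor of the (abelian) number field `K`: the least positive integer `n` such
that `K` embeds into the `n`-th cyclotomic field `ℚ(ζ_n)`. -/
def IsConductor (K : Type*) [Field K] [CharZero K] (p : ℕ) : Prop :=
  IsLeast {n : ℕ | 0 < n ∧ Nonempty (K →ₐ[ℚ] CyclotomicField n ℚ)} p

/-- The squared length `‖f‖² = 2 (|τ₁(f)|² + |τ₂(f)|² + |τ₃(f)|²)`, where `τ₁, τ₂, τ₃` are the
complex embeddings `1, τ, τ²` of `F`, the field `F` being viewed inside `ℂ` through `ι`. -/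
noncomputable def lengthSq {F : Type*} [Field F] [CharZero F]
    (ι : F →+* ℂ) (τ : F ≃ₐ[ℚ] F) (f : F) : ℝ :=
  2 * ∑ i ∈ Finset.range 3, ‖ι ((τ ^ i) f)‖ ^ 2

/-- The ring of integers `O_L` of a subfield `L` of `F`, as a subset of `F`. -/
def integersOf {F : Type*} [Field F] (L : Subfield F) : Set F :=
  {x | x ∈ L ∧ IsIntegral ℤ x}

/-- The set `μ_F` of roots of unity of `F`. -/
def rootsOfUnityOf (F : Type*) [Field F] : Set F :=
  {x | ∃ n : ℕ, 0 < n ∧ x ^ n = 1}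

/-! Let T(z) be the sum of the squares of the three conjugates of z in K, and put γ = f + f̄ = (2α +
β)/t. Then f = (γ + √-d β/t)/2, and the length condition becomes T(γ) + (d/t²) T(β) < 44
(`lengthSq_eq_traceSq`).

The matching lower bound is arithmetic. For integral z in K the form M(z) = `conjForm` is an integer
with 2 M(z) = 3 T(z) - Tr(z)², and it is positive unless z is rational. Each prime dividing p is
totally ramified in K, so σ acts trivially modulo a prime above it; this yields p ∣ M(z). If
moreover d (z/t)² is integral, z is divisible enough above the primes of t to give p t ∣ M(z)
(`IsConductor.mul_gcd_dvd_conjForm`). Hence 2 p t ≤ 3 T(z).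

For β not rational, this bound, together with T(γ) ≥ 3 when γ ≠ 0 (AM-GM on the norm), yields p d/t
≤ 61, which dominates both p and d. For β = b a nonzero integer, t ∣ b gives (d/t²) T(b) ≥ 3 d,
while γ is not rational because f is not in k, so 2 p ≤ 3 T(γ). The residue of d modulo 4 sharpens
the bounds on d. -/

section Conductor

/-! ### Conductors and automorphisms of cyclotomic fields -/

/-- The cyclotomic instance for the canonical `ℚ`-algebra structure of a field of
characteristic zero. -/
instance isCyclotomicExtension_toRatAlgebra (n : ℕ) :
    IsCyclotomicExtension {n} ℚ (CyclotomicField n ℚ) := by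
  have h : @IsCyclotomicExtension {n} ℚ (CyclotomicField n ℚ) _ _
    (CyclotomicField.algebra n ℚ) := inferInstance
  convert! h

variable {K : Type*} [Field K] [CharZero K] {p : ℕ}

/-- If `K` has conductor `p`, then for each prime `q ∣ p` some automorphism of `ℚ(ζ_p)` over
`ℚ(ζ_{p/q})` moves the image of `K`. -/
theorem IsConductor.exists_aut_ne (hp : IsConductor K p)
    (j : K →ₐ[ℚ] CyclotomicField p ℚ) {ζ : CyclotomicField p ℚ} (hζ : IsPrimitiveRoot ζ p)
    {q : ℕ} (hq : q.Prime) (hqp : q ∣ p) :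
    ∃ g : CyclotomicField p ℚ ≃ₐ[ℚ] CyclotomicField p ℚ,
      g (ζ ^ q) = ζ ^ q ∧ ∃ x, g (j x) ≠ j x := by
  have hp0 : 0 < p := hp.1.1
  have : NeZero p := ⟨hp0.ne'⟩
  obtain ⟨m, rfl⟩ := hqp
  have hm : 0 < m := Nat.pos_of_mul_pos_left hp0
  have : NeZero m := ⟨hm.ne'⟩
  -- Otherwise Galois theory places the image of K in ℚ(ζ^q), the (p/q)-th cyclotomic field, against
  -- minimality of p.
  by_contra! H
  have hζm : IsPrimitiveRoot (ζ ^ q) m := hζ.pow hp0 rfl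
  have : IsCyclotomicExtension {m} ℚ ℚ⟮ζ ^ q⟯ :=
    hζm.intermediateField_adjoin_isCyclotomicExtension ℚ
  have : IsGalois ℚ (CyclotomicField (q * m) ℚ) := IsCyclotomicExtension.isGalois {q * m} ℚ _
  have hmem : ∀ x, j x ∈ ℚ⟮ζ ^ q⟯ := by
    intro x
    rw [← IsGalois.fixedField_fixingSubgroup ℚ⟮ζ ^ q⟯, mem_fixedField_iff]
    intro g hg
    refine H g ?_ x
    rw [IntermediateField.mem_fixingSubgroup_iff] at hg
    exact hg _ (mem_adjoin_simple_self ℚ _)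
  have : m ∈ {n : ℕ | 0 < n ∧ Nonempty (K →ₐ[ℚ] CyclotomicField n ℚ)} :=
    ⟨hm, ⟨(IsCyclotomicExtension.algEquiv {m} ℚ ℚ⟮ζ ^ q⟯ (CyclotomicField m ℚ)).toAlgHom.comp
      (j.codRestrict ℚ⟮ζ ^ q⟯.toSubalgebra hmem)⟩⟩
  have h1 := hp.2 this
  have h2 := hq.two_le
  nlinarith

/-- Restriction of automorphisms along an embedding of a normal field. -/
theorem exists_restrict_hom {C : Type*} [Field C] [Algebra ℚ C] [Normal ℚ K] (j : K →ₐ[ℚ] C) :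
    ∃ r : (C ≃ₐ[ℚ] C) →* (K ≃ₐ[ℚ] K), ∀ g x, j (r g x) = g (j x) := by
  let := j.toRingHom.toAlgebra
  have : IsScalarTower ℚ K C := IsScalarTower.of_algebraMap_eq fun x => (j.commutes x).symm
  exact ⟨AlgEquiv.restrictNormalHom K, fun g x => g.restrictNormal_commutes K x⟩

theorem aut_pow_apply_of_eq_pow {C : Type*} [Field C] [Algebra ℚ C] {g : C ≃ₐ[ℚ] C} {x : C} {a : ℕ}
    (h : g x = x ^ a) (n : ℕ) : (g ^ n) x = x ^ (a ^ n) := by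
  induction n with
  | zero => simp
  | succ n ih => rw [pow_succ, AlgEquiv.mul_apply, h, map_pow, ih, ← pow_mul, pow_succ]

/-- An automorphism of a cyclotomic field is determined by a primitive root. -/
theorem cyclotomic_aut_ext [NeZero p] {ζ : CyclotomicField p ℚ} (hζ : IsPrimitiveRoot ζ p)
    {g h : CyclotomicField p ℚ ≃ₐ[ℚ] CyclotomicField p ℚ} (hgh : g ζ = h ζ) : g = h := by
  apply AlgEquiv.coe_toAlgHom_injective
  apply (hζ.powerBasis ℚ).algHom_ext
  simpa [IsPrimitiveRoot.powerBasis_gen] using hgh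

theorem cyclotomic_aut_pow_eq_one [NeZero p] {ζ : CyclotomicField p ℚ} (hζ : IsPrimitiveRoot ζ p)
    {g : CyclotomicField p ℚ ≃ₐ[ℚ] CyclotomicField p ℚ} {a n : ℕ} (hg : g ζ = ζ ^ a)
    (ha : a ^ n ≡ 1 [MOD p]) : g ^ n = 1 := by
  refine cyclotomic_aut_ext hζ ?_
  rw [aut_pow_apply_of_eq_pow hg, AlgEquiv.one_apply]
  conv_rhs => rw [← pow_one ζ]
  exact pow_eq_pow_of_modEq ha hζ.pow_eq_one

theorem exists_cyclotomic_aut [NeZero p] {ζ : CyclotomicField p ℚ} (hζ : IsPrimitiveRoot ζ p)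
    {a : ℕ} (ha : a.Coprime p) :
    ∃ g : CyclotomicField p ℚ ≃ₐ[ℚ] CyclotomicField p ℚ, g ζ = ζ ^ a := by
  have hirr := Polynomial.cyclotomic.irreducible_rat (NeZero.pos p)
  obtain ⟨i, -, hi⟩ :=
    (IsCyclotomicExtension.zeta_spec p ℚ (CyclotomicField p ℚ)).eq_pow_of_pow_eq_one hζ.pow_eq_one
  refine ⟨IsCyclotomicExtension.fromZetaAut
    ((IsCyclotomicExtension.zeta_spec p ℚ (CyclotomicField p ℚ)).pow_of_coprime a ha) hirr, ?_⟩
  rw [← hi, map_pow, IsCyclotomicExtension.fromZetaAut_spec]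
  ring

/-- An automorphism fixing `ζ ^ q` raises `ζ` to a power that is `1` modulo `p / q`. -/
theorem exists_apply_eq_pow_one_add {m q : ℕ} [NeZero (q * m)] {ζ : CyclotomicField (q * m) ℚ}
    (hζ : IsPrimitiveRoot ζ (q * m))
    {g : CyclotomicField (q * m) ℚ ≃ₐ[ℚ] CyclotomicField (q * m) ℚ} (hg : g (ζ ^ q) = ζ ^ q) :
    ∃ k : ℕ, g ζ = ζ ^ (1 + m * k) := by
  have hp0 : 0 < q * m := NeZero.pos _
  have hq0 : q ≠ 0 := (Nat.pos_of_mul_pos_right hp0).ne'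
  have hη : IsPrimitiveRoot (ζ ^ m) q := hζ.pow hp0 (mul_comm _ _)
  have hζ0 : ζ ≠ 0 := hζ.ne_zero hp0.ne'
  have : NeZero q := ⟨hq0⟩
  have h1 : (g ζ / ζ) ^ q = 1 := by
    rw [div_pow, ← map_pow, hg, div_self (pow_ne_zero _ hζ0)]
  obtain ⟨k, -, hk⟩ := hη.eq_pow_of_pow_eq_one h1
  refine ⟨k, ?_⟩
  rw [pow_add, pow_one, pow_mul, hk, mul_div_cancel₀ _ hζ0]

end Conductor

/-! ### Conductor and ramification of a cyclic cubic field -/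

section Cubic

variable {K : Type*} [Field K] [NumberField K] [IsGalois ℚ K] {p : ℕ}

/-- The shape of the conductor of a cyclic cubic field. -/
theorem IsConductor.shape_of_finrank_eq_three (h3 : Module.finrank ℚ K = 3)
    (hp : IsConductor K p) {q : ℕ} (hq : q.Prime) (hqp : q ∣ p) :
    q ≠ 2 ∧ (q ^ 2 ∣ p → q = 3) ∧ (q = 3 → ¬ 27 ∣ p) := by
  obtain ⟨j⟩ := hp.1.2
  have : NeZero p := ⟨hp.1.1.ne'⟩
  have hζ := IsCyclotomicExtension.zeta_spec p ℚ (CyclotomicField p ℚ)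
  set ζ := IsCyclotomicExtension.zeta p ℚ (CyclotomicField p ℚ)
  obtain ⟨g, hg, x, hx⟩ := hp.exists_aut_ne j hζ hq hqp
  obtain ⟨r, hr⟩ := exists_restrict_hom j
  have hcard : Nat.card (K ≃ₐ[ℚ] K) = 3 := by rw [IsGalois.card_aut_eq_finrank, h3]
  have hr3 : ∀ h, r h ^ 3 = 1 := fun h => by rw [← hcard, pow_card_eq_one']
  have hrg : r g ≠ 1 := fun h => hx (by rw [← hr, h]; rfl)
  have hord : orderOf (r g) = 3 :=
    orderOf_eq_prime (hr3 g) hrg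
  have hdvd : ∀ n, g ^ n = 1 → 3 ∣ n := fun n hn => by
    rw [← hord]
    exact orderOf_dvd_of_pow_eq_one (by rw [← map_pow, hn, map_one])
  obtain ⟨m, rfl⟩ := hqp
  obtain ⟨k, hk⟩ := exists_apply_eq_pow_one_add hζ hg
  refine ⟨?_, ?_, ?_⟩
  · rintro rfl
    have h2 : g ^ 2 = 1 := by
      refine cyclotomic_aut_pow_eq_one hζ hk ?_
      -- For m k odd, 1 + m k would share the factor 2 with 2 m, yet g ζ is again a primitive root.
      have hmk : 2 ∣ m * k := by
        by_contra hodd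
        have h1 : IsPrimitiveRoot (ζ ^ (1 + m * k)) (2 * m) := hk ▸ hζ.map_of_injective g.injective
        have h2 := (hζ.pow_iff_coprime (NeZero.pos _) _).1 h1
        have h3 : 2 ∣ 1 + m * k := by omega
        have := Nat.dvd_gcd h3 (Dvd.intro m rfl)
        rw [h2] at this
        omega
      obtain ⟨c, hc⟩ : 2 ∣ m * k * k := hmk.mul_right k
      have : (1 + m * k) ^ 2 = 1 + 2 * m * (k + c) := by
        calc (1 + m * k) ^ 2 = 1 + 2 * m * k + m * (m * k * k) := by ring
          _ = _ := by rw [hc]; ring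
      rw [this]
      simp [Nat.ModEq]
    have := hdvd 2 h2
    omega
  · intro hqq
    have hqm : q ∣ m := by
      rw [sq] at hqq
      exact Nat.dvd_of_mul_dvd_mul_left hq.pos hqq
    obtain ⟨c, rfl⟩ := hqm
    -- As q divides p/q, an exponent that is 1 modulo p/q has q-th power 1 modulo p. So the order of
    -- g divides q, and 3 divides q.
    have h2 : g ^ q = 1 := by
      refine cyclotomic_aut_pow_eq_one hζ hk ?_
      obtain ⟨y, hy⟩ : ∃ y, (1 + q * c * k) ^ q = 1 + q * (q * c * k) + (q * c * k) ^ 2 * y := by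
        generalize q * c * k = x
        generalize q = n
        induction n with
        | zero => exact ⟨0, by simp⟩
        | succ n ih =>
          obtain ⟨y, hy⟩ := ih
          exact ⟨n + y + x * y, by rw [pow_succ, hy]; ring⟩
      have : (1 + q * c * k) ^ q = 1 + q * (q * c) * (k + c * k ^ 2 * y) := by rw [hy]; ring
      rw [this]
      simp [Nat.ModEq]
    exact ((Nat.prime_dvd_prime_iff_eq Nat.prime_three hq).1 (hdvd q h2)).symm
  · rintro rfl h27
    obtain ⟨n, rfl⟩ : 9 ∣ m := by omega
    -- With p = 27 n, the cube of 1 + 3 n k is 1 + 9 n k modulo p. So g is a cube, and cubes die in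
    -- a group of order 3.
    have hco : (1 + 3 * n * k).Coprime (3 * (9 * n)) := by
      have h1 : (1 + 3 * n * k).Coprime (3 * n) := by simp
      have h2 : (1 + 3 * n * k).Coprime 3 := h1.coprime_dvd_right (Dvd.intro n rfl)
      have h3 : (1 + 3 * n * k).Coprime n := h1.coprime_dvd_right (Dvd.intro_left 3 rfl)
      exact h2.mul_right ((Nat.Coprime.pow_right 2 h2).mul_right h3)
    obtain ⟨g', hg'⟩ := exists_cyclotomic_aut hζ hco
    have : g' ^ 3 = g := by
      refine cyclotomic_aut_ext hζ ?_
      rw [aut_pow_apply_of_eq_pow hg', hk]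
      refine pow_eq_pow_of_modEq ?_ hζ.pow_eq_one
      have : (1 + 3 * n * k) ^ 3 = 1 + 9 * n * k + 3 * (9 * n) * (n * k ^ 2 + n ^ 2 * k ^ 3) := by
        ring
      rw [this]
      simp [Nat.ModEq]
    exact hrg (by rw [← this, map_pow, hr3])

/-- Total ramification in the form needed: the whole Galois group is inertia. The automorphism
fixing ζ^q but moving K is inertial at a prime above q in the cyclotomic field, and its restriction
generates the Galois group of K. -/
theorem IsConductor.exists_ideal (h3 : Module.finrank ℚ K = 3)
    (hp : IsConductor K p) {q : ℕ} (hq : q.Prime) (hqp : q ∣ p) :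
    ∃ P : Ideal (𝓞 K), (∀ n : ℤ, (n : 𝓞 K) ∈ P → (q : ℤ) ∣ n) ∧
      ∀ (g : K ≃ₐ[ℚ] K) (z w : 𝓞 K), (w : K) = g z - z → w ∈ P := by
  obtain ⟨j⟩ := hp.1.2
  have : NeZero p := ⟨hp.1.1.ne'⟩
  have hζ := IsCyclotomicExtension.zeta_spec p ℚ (CyclotomicField p ℚ)
  set ζ := IsCyclotomicExtension.zeta p ℚ (CyclotomicField p ℚ)
  obtain ⟨g, hg, x, hx⟩ := hp.exists_aut_ne j hζ hq hqp
  obtain ⟨r, hr⟩ := exists_restrict_hom j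
  have hcard : Nat.card (K ≃ₐ[ℚ] K) = 3 := by rw [IsGalois.card_aut_eq_finrank, h3]
  have hrg : r g ≠ 1 := fun h => hx (by rw [← hr, h]; rfl)
  have hgen : ∀ h : K ≃ₐ[ℚ] K, ∃ n : ℕ, r g ^ n = h := by
    intro h
    have : Fact (Nat.Prime 3) := ⟨Nat.prime_three⟩
    simpa [Submonoid.mem_powers_iff] using mem_powers_of_prime_card hcard hrg (g' := h)
  obtain ⟨Q, hQ, hQq⟩ : ∃ Q : Ideal (𝓞 (CyclotomicField p ℚ)), Q.IsPrime ∧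
      Q.comap (algebraMap ℤ _) = Ideal.span {(q : ℤ)} := by
    have : (Ideal.span {(q : ℤ)}).IsPrime :=
      (Ideal.span_singleton_prime (by exact_mod_cast hq.ne_zero)).2 (Nat.prime_iff_prime_int.1 hq)
    obtain ⟨Q, -, h1, h2⟩ := Ideal.exists_ideal_over_prime_of_isIntegral
      (S := 𝓞 (CyclotomicField p ℚ)) (Ideal.span {(q : ℤ)}) ⊥ (fun n hn => by
        have : (n : 𝓞 (CyclotomicField p ℚ)) = 0 := by simpa using hn
        rw [Int.cast_eq_zero.1 this]
        exact zero_mem _)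
    exact ⟨Q, h1, h2⟩
  have hgQ : ∀ z w : 𝓞 (CyclotomicField p ℚ), (w : CyclotomicField p ℚ) = g z - z → w ∈ Q := by
    let G := RingOfIntegers.mapRingHom (g : CyclotomicField p ℚ →+* CyclotomicField p ℚ)
    have hqQ : (q : 𝓞 (CyclotomicField p ℚ)) ∈ Q := by
      have : (q : ℤ) ∈ Q.comap (algebraMap ℤ (𝓞 (CyclotomicField p ℚ))) :=
        hQq ▸ Ideal.mem_span_singleton_self _
      simpa using this
    -- The q-th powers of ζ and its image agree, so the q-th power of their difference is a multiple
    -- of q.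
    have hζQ : G hζ.toInteger - hζ.toInteger ∈ Q := by
      have hG : G hζ.toInteger ^ q = hζ.toInteger ^ q := by
        refine RingOfIntegers.coe_injective ?_
        rw [map_pow, map_pow]
        change g ζ ^ q = ζ ^ q
        rw [← map_pow, hg]
      obtain ⟨y, hy⟩ := exists_add_pow_prime_eq hq (G hζ.toInteger - hζ.toInteger) hζ.toInteger
      rw [sub_add_cancel, hG] at hy
      refine hQ.mem_of_pow_mem q ?_
      have : (G hζ.toInteger - hζ.toInteger) ^ q =
          q * (-((G hζ.toInteger - hζ.toInteger) * hζ.toInteger * y)) := by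
        linear_combination -hy
      rw [this]
      exact Q.mul_mem_right _ hqQ
    have hall : ∀ z, G z - z ∈ Q := by
      intro z
      have hz : z ∈ Algebra.adjoin ℤ {hζ.toInteger} := by
        rw [IsCyclotomicExtension.Rat.adjoin_singleton_eq_top hζ]
        trivial
      induction hz using Algebra.adjoin_induction with
      | mem x hx =>
        obtain rfl := hx
        exact hζQ
      | algebraMap n => simp
      | add x y _ _ hx hy =>
        rw [map_add, add_sub_add_comm]
        exact Q.add_mem hx hy
      | mul x y _ _ hx hy =>
        have : G (x * y) - x * y = G x * (G y - y) + (G x - x) * y := by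
          rw [map_mul]; ring
        rw [this]
        exact Q.add_mem (Q.mul_mem_left _ hy) (Q.mul_mem_right _ hx)
    intro z w hw
    convert hall z
    exact RingOfIntegers.ext hw
  refine ⟨Q.comap (RingOfIntegers.mapRingHom j.toRingHom), ?_, ?_⟩
  · intro n hn
    have : n ∈ Q.comap (algebraMap ℤ (𝓞 (CyclotomicField p ℚ))) := by
      simpa [Ideal.mem_comap] using hn
    rwa [hQq, Ideal.mem_span_singleton] at this
  · intro h
    obtain ⟨n, rfl⟩ := hgen h
    induction n with
    | zero =>
      intro z w hw
      have : w = 0 := RingOfIntegers.ext (by simpa using hw)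
      simp [this]
    | succ n ih =>
      intro z w hw
      let z' : 𝓞 K := RingOfIntegers.mapRingHom ((r g ^ n : K ≃ₐ[ℚ] K) : K →+* K) z
      have hz' : (z' : K) = (r g ^ n) z := rfl
      let w' : 𝓞 K := RingOfIntegers.mapRingHom ((r g : K ≃ₐ[ℚ] K) : K →+* K) z' - z'
      have hww : w = w' + (z' - z) := by
        apply RingOfIntegers.ext
        rw [hw, pow_succ']
        simp [w', z']
      rw [hww]
      refine Ideal.add_mem _ ?_ (ih z _ (by simp [hz']))
      rw [Ideal.mem_comap]
      apply hgQ (RingOfIntegers.mapRingHom j.toRingHom z')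
      simp [w', hr]

end Cubic

/-! ### Divisibility forced by a square cubic discriminant -/

section IntegerArithmetic

theorem Int.sq_dvd_of_pow_three_dvd_sq {q a : ℤ} (hq : Prime q) (h : q ^ 3 ∣ a ^ 2) : q ^ 2 ∣ a := by
  obtain ⟨b, rfl⟩ : q ∣ a := hq.dvd_of_dvd_pow ((dvd_pow_self q three_ne_zero).trans h)
  have h1 : q ∣ b ^ 2 := by
    have : q ^ 2 * q ∣ q ^ 2 * b ^ 2 := by
      convert h using 1 <;> ring
    exact (mul_dvd_mul_iff_left (pow_ne_zero 2 hq.ne_zero)).1 this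
  obtain ⟨c, rfl⟩ := hq.dvd_of_dvd_pow h1
  exact ⟨c, by ring⟩

theorem nine_dvd_of_disc_identity {M A D : ℤ} (hM : 3 ∣ M) (hD : 3 ∣ D)
    (h : 4 * M ^ 3 = A ^ 2 + 27 * D ^ 2) : 9 ∣ M := by
  obtain ⟨m, rfl⟩ := hM
  obtain ⟨n, rfl⟩ := hD
  have h9 : (3 : ℤ) ^ 2 ∣ A :=
    Int.sq_dvd_of_pow_three_dvd_sq Int.prime_three ⟨4 * m ^ 3 - 9 * n ^ 2, by linarith⟩
  obtain ⟨a, rfl⟩ := h9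
  have h3 : (3 : ℤ) ∣ m ^ 3 := by
    have h4 : 4 * m ^ 3 = 3 * (a ^ 2 + 3 * n ^ 2) := by linarith
    omega
  obtain ⟨c, rfl⟩ := Int.prime_three.dvd_of_dvd_pow h3
  exact ⟨c, by ring⟩

/-- The discriminant of the cubic `X ^ 3 - e₁ X ^ 2 + e₂ X - e₃`. -/
def cubicDisc (e₁ e₂ e₃ : ℤ) : ℤ :=
  e₁ ^ 2 * e₂ ^ 2 - 4 * e₂ ^ 3 - 4 * e₁ ^ 3 * e₃ + 18 * e₁ * e₂ * e₃ - 27 * e₃ ^ 2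

/-- With e₂ = q v, every term of the discriminant identity except 4 q³ v³ is divisible by q⁴; since
q is odd, q ∣ v. -/
theorem sq_dvd_of_cubicDisc_eq_sq {q e₁ e₂ e₃ D : ℤ} (hq : Prime q) (hq2 : ¬ q ∣ 2)
    (h1 : q ∣ e₁) (h2 : q ∣ e₂) (h3 : q ^ 2 ∣ e₃) (hD : D ^ 2 = cubicDisc e₁ e₂ e₃) :
    q ^ 2 ∣ e₂ := by
  obtain ⟨u, rfl⟩ := h1
  obtain ⟨v, rfl⟩ := h2
  obtain ⟨w, rfl⟩ := h3
  unfold cubicDisc at hD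
  obtain ⟨c, rfl⟩ : q ^ 2 ∣ D := Int.sq_dvd_of_pow_three_dvd_sq hq
    ⟨q * u ^ 2 * v ^ 2 - 4 * v ^ 3 - 4 * q ^ 2 * u ^ 3 * w + 18 * q * u * v * w
      - 27 * q * w ^ 2, by rw [hD]; ring⟩
  have hv : q ∣ 2 * 2 * v ^ 3 := by
    refine ⟨u ^ 2 * v ^ 2 - 4 * q * u ^ 3 * w + 18 * u * v * w - 27 * w ^ 2 - c ^ 2, ?_⟩
    refine mul_left_cancel₀ (pow_ne_zero 3 hq.ne_zero) ?_
    linear_combination hD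
  have hqv : q ∣ v := by
    rcases hq.dvd_or_dvd hv with h | h
    · rcases hq.dvd_or_dvd h with h | h <;> exact absurd h hq2
    · exact hq.dvd_of_dvd_pow h
  obtain ⟨x, rfl⟩ := hqv
  exact ⟨x, by ring⟩

theorem twentySeven_dvd_of_cubicDisc_eq_sq {e₁ e₂ e₃ D : ℤ}
    (h1 : 3 ∣ e₁) (h2 : 9 ∣ e₂) (h3 : 9 ∣ e₃) (hD : D ^ 2 = cubicDisc e₁ e₂ e₃) : 27 ∣ D := by
  obtain ⟨u, rfl⟩ := h1
  obtain ⟨v, rfl⟩ := h2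
  obtain ⟨w, rfl⟩ := h3
  unfold cubicDisc at hD
  have h3 : (3 : ℤ) ^ 2 ∣ D := Int.sq_dvd_of_pow_three_dvd_sq Int.prime_three
    ⟨27 * u ^ 2 * v ^ 2 - 108 * v ^ 3 - 36 * u ^ 3 * w + 162 * u * v * w - 81 * w ^ 2,
      by rw [hD]; ring⟩
  obtain ⟨c, rfl⟩ := h3
  have : (3 : ℤ) ∣ c ^ 2 := ⟨3 * u ^ 2 * v ^ 2 - 12 * v ^ 3 - 4 * u ^ 3 * w + 18 * u * v * w
    - 9 * w ^ 2, by linarith⟩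
  obtain ⟨x, rfl⟩ := Int.prime_three.dvd_of_dvd_pow this
  exact ⟨x, by ring⟩

theorem Nat.Prime.le_of_pow_dvd_mul {q a b i j k : ℕ} (hq : q.Prime) (ha : ¬ q ^ (i + 1) ∣ a)
    (hb : ¬ q ^ (j + 1) ∣ b) (h : q ^ k ∣ a * b) : k ≤ i + j := by
  have ha0 : a ≠ 0 := by rintro rfl; simp at ha
  have hb0 : b ≠ 0 := by rintro rfl; simp at hb
  rw [hq.pow_dvd_iff_le_factorization ha0] at ha
  rw [hq.pow_dvd_iff_le_factorization hb0] at hb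
  rw [hq.pow_dvd_iff_le_factorization (mul_ne_zero ha0 hb0), Nat.factorization_mul ha0 hb0,
    Finsupp.add_apply] at h
  omega

end IntegerArithmetic

/-- The quadratic form `z² + z'² + z''² - z z' - z' z'' - z'' z` in the conjugates of `z`. -/
def conjForm {K : Type*} [Field K] (σ : K → K) (z : K) : K :=
  z ^ 2 + σ z ^ 2 + σ (σ z) ^ 2 - z * σ z - σ z * σ (σ z) - σ (σ z) * z

/-! ### Rational integers in a cyclic cubic field -/

section CyclicCubic

variable {K : Type*} [Field K] [NumberField K]

theorem Int.dvd_of_isIntegral_div {m n : ℤ} (hm : m ≠ 0) (h : IsIntegral ℤ ((n : K) / m)) :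
    m ∣ n := by
  have h1 : IsIntegral ℤ ((n : ℚ) / m) := by
    rw [← isIntegral_algebraMap_iff (algebraMap ℚ K).injective]
    simpa using h
  obtain ⟨c, hc⟩ := IsIntegrallyClosed.isIntegral_iff.1 h1
  refine ⟨c, ?_⟩
  have hm' : (m : ℚ) ≠ 0 := by exact_mod_cast hm
  rw [eq_div_iff hm', eq_intCast] at hc
  have : c * m = n := by exact_mod_cast hc
  rw [← this, mul_comm]

variable [IsGalois ℚ K]

theorem apply_apply_apply_of_finrank_eq_three (h3 : Module.finrank ℚ K = 3)
    (σ : K ≃ₐ[ℚ] K) (z : K) : σ (σ (σ z)) = z := by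
  have hcard : Nat.card (K ≃ₐ[ℚ] K) = 3 := by rw [IsGalois.card_aut_eq_finrank, h3]
  have : σ ^ 3 = 1 := by rw [← hcard, pow_card_eq_one']
  calc σ (σ (σ z)) = (σ ^ 3) z := rfl
    _ = z := by rw [this]; rfl

theorem exists_int_of_apply_eq (h3 : Module.finrank ℚ K = 3) {σ : K ≃ₐ[ℚ] K}
    (hσ : σ ≠ 1) {x : K} (hx : IsIntegral ℤ x) (h : σ x = x) :
    ∃ n : ℤ, (n : K) = x := by
  have hcard : Nat.card (K ≃ₐ[ℚ] K) = 3 := by rw [IsGalois.card_aut_eq_finrank, h3]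
  have hfix : ∀ g : K ≃ₐ[ℚ] K, g x = x := by
    intro g
    have : Fact (Nat.Prime 3) := ⟨Nat.prime_three⟩
    obtain ⟨n, rfl⟩ := mem_powers_of_prime_card hcard hσ (g' := g)
    dsimp only
    induction n with
    | zero => rfl
    | succ n ih => rw [pow_succ, AlgEquiv.mul_apply, h, ih]
  obtain ⟨r, rfl⟩ := (IsGalois.mem_range_algebraMap_iff_fixed x).2 hfix
  rw [isIntegral_algebraMap_iff (algebraMap ℚ K).injective] at hx
  obtain ⟨n, rfl⟩ := IsIntegrallyClosed.isIntegral_iff.1 hx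
  exact ⟨n, by simp⟩

end CyclicCubic

/-! ### Divisibility of the conjugate form by p and gcd(p, d) -/

section CyclicCubicDivisibility

theorem IsIntegral.of_eq {A : Type*} [CommRing A] {a b : A} (h : IsIntegral ℤ a) (e : b = a) :
    IsIntegral ℤ b := e ▸ h

theorem sq_eq_cubicDisc {K : Type*} [Field K] [CharZero K] {x y z : K} {e₁ e₂ e₃ D : ℤ} (h₁ : (e₁ : K) = x + y + z)
    (h₂ : (e₂ : K) = x * y + y * z + z * x) (h₃ : (e₃ : K) = x * y * z)
    (hD : (D : K) = (y - x) * (z - y) * (x - z)) : D ^ 2 = cubicDisc e₁ e₂ e₃ := by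
  have : ((D ^ 2 : ℤ) : K) = (cubicDisc e₁ e₂ e₃ : ℤ) := by
    unfold cubicDisc
    push_cast
    rw [h₁, h₂, h₃, hD]
    ring
  exact_mod_cast this

theorem conjForm_eq {K : Type*} [Field K] {σ : K → K} {z : K} {e₁ e₂ : ℤ} (h₁ : (e₁ : K) = z + σ z + σ (σ z))
    (h₂ : (e₂ : K) = z * σ z + σ z * σ (σ z) + σ (σ z) * z) :
    conjForm σ z = ((e₁ ^ 2 - 3 * e₂ : ℤ) : K) := by
  push_cast
  rw [h₁, h₂, conjForm]
  ring

variable {K : Type*} [Field K] [NumberField K]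

/-- If `z ^ 2 / q` is integral, so that `z` is divisible by the square of a prime above a totally
ramified `q`, then the symmetric functions of `z` are divisible by powers of `q`. -/
theorem dvd_symmetric_of_isIntegral_sq_div {σ : K ≃ₐ[ℚ] K} {q : ℕ} (hq : q.Prime) (hq2 : q ≠ 2) {z : K} (hzq : IsIntegral ℤ (z ^ 2 / q))
    {e₁ e₂ e₃ D : ℤ}
    (h₁ : (e₁ : K) = z + σ z + σ (σ z)) (h₂ : (e₂ : K) = z * σ z + σ z * σ (σ z) + σ (σ z) * z)
    (h₃ : (e₃ : K) = z * σ z * σ (σ z))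
    (hD : (D : K) = (σ z - z) * (σ (σ z) - σ z) * (z - σ (σ z))) :
    (q : ℤ) ∣ e₁ ∧ (q : ℤ) ^ 2 ∣ e₂ ∧ (q : ℤ) ^ 2 ∣ e₃ := by
  have hqZ : Prime (q : ℤ) := Nat.prime_iff_prime_int.1 hq
  have hqK : (q : K) ≠ 0 := by exact_mod_cast hq.ne_zero
  have hw1 : IsIntegral ℤ (σ z ^ 2 / q) := by
    simpa using hzq.map (σ : K →+* K).toIntAlgHom
  have hw2 : IsIntegral ℤ (σ (σ z) ^ 2 / q) := by
    simpa using hw1.map (σ : K →+* K).toIntAlgHom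
  have hmul : ∀ x y : K, IsIntegral ℤ (x ^ 2 / q) → IsIntegral ℤ (y ^ 2 / q) →
      IsIntegral ℤ (x * y / q) := by
    intro x y hx hy
    refine IsIntegral.of_pow two_pos ?_
    exact (hx.mul hy).of_eq (by field_simp)
  have d2 : (q : ℤ) ∣ e₂ := by
    refine Int.dvd_of_isIntegral_div (K := K) hqZ.ne_zero ?_
    refine (((hmul _ _ hzq hw1).add (hmul _ _ hw1 hw2)).add (hmul _ _ hw2 hzq)).of_eq ?_
    rw [h₂]
    push_cast
    field_simp
  have d1 : (q : ℤ) ∣ e₁ := by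
    refine hqZ.dvd_of_dvd_pow (n := 2) ?_
    have : (q : ℤ) ∣ e₁ ^ 2 - 2 * e₂ := by
      refine Int.dvd_of_isIntegral_div (K := K) hqZ.ne_zero ?_
      refine ((hzq.add hw1).add hw2).of_eq ?_
      push_cast
      rw [h₁, h₂]
      field_simp
      ring
    have := this.add (d2.mul_left 2)
    simpa using this
  have d3 : (q : ℤ) ^ 2 ∣ e₃ := by
    refine Int.sq_dvd_of_pow_three_dvd_sq hqZ ?_
    refine Int.dvd_of_isIntegral_div (K := K) (pow_ne_zero 3 hqZ.ne_zero) ?_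
    refine ((hzq.mul hw1).mul hw2).of_eq ?_
    push_cast
    rw [h₃]
    field_simp
  refine ⟨d1, sq_dvd_of_cubicDisc_eq_sq hqZ ?_ d1 d2 d3 (sq_eq_cubicDisc h₁ h₂ h₃ hD), d3⟩
  intro h
  have : q ∣ 2 := by exact_mod_cast h
  exact hq2 ((Nat.prime_dvd_prime_iff_eq hq Nat.prime_two).1 this)

/-- Write d = q c with c prime to q. The hypothesis makes c z²/q integral, as q (z²/q) = z² is, and
Bézout combines the two. -/
theorem isIntegral_sq_div_of_dvd {t d q : ℕ} (hd : Squarefree d) (htd : t ∣ d) (hq : q.Prime)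
    (hqt : q ∣ t) {z : K} (hz : IsIntegral ℤ z)
    (hzd : IsIntegral ℤ ((d : K) * (z / (t : K)) ^ 2)) : IsIntegral ℤ (z ^ 2 / q) := by
  obtain ⟨s, rfl⟩ := hqt
  obtain ⟨c, rfl⟩ : q ∣ d := (Dvd.intro s rfl).trans htd
  have hqc : q.Coprime c := Nat.coprime_of_squarefree_mul hd
  have hs0 : s ≠ 0 := by
    rintro rfl
    rw [mul_zero, zero_dvd_iff] at htd
    exact hd.ne_zero htd
  have hsK : (s : K) ≠ 0 := by exact_mod_cast hs0
  have hqK : (q : K) ≠ 0 := by exact_mod_cast hq.ne_zero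
  have h1 : IsIntegral ℤ ((c : K) * (z ^ 2 / q)) := by
    refine (hzd.mul ((isIntegral_algebraMap (R := ℤ) (A := K) (x := (s : ℤ))).pow 2)).of_eq ?_
    rw [eq_intCast]
    push_cast
    field_simp
  have hb := Nat.gcd_eq_gcd_ab q c
  rw [hqc] at hb
  have hbK : (1 : K) = q * (Nat.gcdA q c : ℤ) + c * (Nat.gcdB q c : ℤ) := by exact_mod_cast hb
  have h2 := ((isIntegral_algebraMap (R := ℤ) (A := K) (x := Nat.gcdA q c)).mul (hz.pow 2)).add
    ((isIntegral_algebraMap (R := ℤ) (A := K) (x := Nat.gcdB q c)).mul h1)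
  refine h2.of_eq ?_
  rw [eq_intCast, eq_intCast]
  field_simp
  linear_combination hbK * z ^ 2

variable [IsGalois ℚ K]

/-- The elementary symmetric functions and the square root of the discriminant of an integral
element of a cyclic cubic field. -/
theorem exists_int_symmetric (h3 : Module.finrank ℚ K = 3) {σ : K ≃ₐ[ℚ] K} (hσ : σ ≠ 1) {z : K}
    (hz : IsIntegral ℤ z) : ∃ e₁ e₂ e₃ D : ℤ,
      (e₁ : K) = z + σ z + σ (σ z) ∧ (e₂ : K) = z * σ z + σ z * σ (σ z) + σ (σ z) * z ∧
      (e₃ : K) = z * σ z * σ (σ z) ∧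
      (D : K) = (σ z - z) * (σ (σ z) - σ z) * (z - σ (σ z)) := by
  have hs := apply_apply_apply_of_finrank_eq_three h3 σ z
  have hz1 : IsIntegral ℤ (σ z) := hz.map (σ : K →+* K).toIntAlgHom
  have hz2 : IsIntegral ℤ (σ (σ z)) := hz1.map (σ : K →+* K).toIntAlgHom
  obtain ⟨e₁, h₁⟩ := exists_int_of_apply_eq h3 hσ ((hz.add hz1).add hz2)
    (by simp only [map_add, hs]; ring)
  obtain ⟨e₂, h₂⟩ := exists_int_of_apply_eq h3 hσ
    (((hz.mul hz1).add (hz1.mul hz2)).add (hz2.mul hz)) (by simp only [map_add, map_mul, hs]; ring)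
  obtain ⟨e₃, h₃⟩ := exists_int_of_apply_eq h3 hσ ((hz.mul hz1).mul hz2)
    (by simp only [map_mul, hs]; ring)
  obtain ⟨D, hD⟩ := exists_int_of_apply_eq h3 hσ
    (((hz1.sub hz).mul (hz2.sub hz1)).mul (hz.sub hz2)) (by simp only [map_sub, map_mul, hs]; ring)
  exact ⟨e₁, e₂, e₃, D, h₁, h₂, h₃, hD⟩

variable {p : ℕ}

theorem IsConductor.dvd_conjForm (h3 : Module.finrank ℚ K = 3) (hp : IsConductor K p)
    {σ : K ≃ₐ[ℚ] K} {q : ℕ} (hq : q.Prime) (hqp : q ∣ p) {z : K} (hz : IsIntegral ℤ z) {M D : ℤ}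
    (hM : (M : K) = conjForm σ z) (hD : (D : K) = (σ z - z) * (σ (σ z) - σ z) * (z - σ (σ z))) :
    (q : ℤ) ∣ M ∧ (q : ℤ) ∣ D := by
  obtain ⟨P, hP, hPσ⟩ := hp.exists_ideal h3 hq hqp
  have hz1 : IsIntegral ℤ (σ z) := hz.map (σ : K →+* K).toIntAlgHom
  have hz2 : IsIntegral ℤ (σ (σ z)) := hz1.map (σ : K →+* K).toIntAlgHom
  let Z : 𝓞 K := ⟨z, hz⟩
  let Z₁ : 𝓞 K := ⟨σ z, hz1⟩
  let Z₂ : 𝓞 K := ⟨σ (σ z), hz2⟩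
  have h0 : Z₁ - Z ∈ P := hPσ σ Z _ rfl
  have h1 : Z₂ - Z₁ ∈ P := hPσ σ Z₁ _ rfl
  constructor
  · apply hP
    have : (M : 𝓞 K) = (Z₁ - Z) * (Z₁ - Z) + (Z₂ - Z₁) * ((Z₁ - Z) + (Z₂ - Z₁)) := by
      apply RingOfIntegers.coe_injective
      have : (M : K) = (σ z - z) * (σ z - z) + (σ (σ z) - σ z) * ((σ z - z) + (σ (σ z) - σ z)) := by
        rw [hM, conjForm]; ring
      simp only [map_intCast, map_add, map_mul, map_sub]
      exact this
    rw [this]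
    exact P.add_mem (P.mul_mem_right _ h0) (P.mul_mem_right _ h1)
  · apply hP
    have : (D : 𝓞 K) = (Z₁ - Z) * (Z₂ - Z₁) * (Z - Z₂) := by
      apply RingOfIntegers.coe_injective
      simp only [map_intCast, map_mul, map_sub]
      exact hD
    rw [this]
    exact P.mul_mem_right _ (P.mul_mem_right _ h0)

/-- Ramification gives only one factor 3; the second comes from 4 M³ = A² + 27 D². -/
theorem IsConductor.nine_dvd_conjForm (h3 : Module.finrank ℚ K = 3) (hp : IsConductor K p)
    {σ : K ≃ₐ[ℚ] K} (hσ : σ ≠ 1) (hqp : 3 ∣ p) {z : K} (hz : IsIntegral ℤ z) {M : ℤ}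
    (hM : (M : K) = conjForm σ z) : 9 ∣ M := by
  obtain ⟨e₁, e₂, e₃, D, h₁, h₂, h₃, hD⟩ := exists_int_symmetric h3 hσ hz
  obtain ⟨hM3, hD3⟩ := hp.dvd_conjForm h3 Nat.prime_three hqp hz hM hD
  refine nine_dvd_of_disc_identity (A := 2 * e₁ ^ 3 - 9 * e₁ * e₂ + 27 * e₃) hM3 hD3 ?_
  rw [conjForm_eq h₁ h₂] at hM
  obtain rfl : M = e₁ ^ 2 - 3 * e₂ := by exact_mod_cast hM
  rw [sq_eq_cubicDisc h₁ h₂ h₃ hD, cubicDisc]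
  ring

theorem sq_dvd_conjForm_of_isIntegral_sq_div (h3 : Module.finrank ℚ K = 3) {σ : K ≃ₐ[ℚ] K}
    (hσ : σ ≠ 1) {q : ℕ} (hq : q.Prime) (hq2 : q ≠ 2) {z : K} (hz : IsIntegral ℤ z)
    (hzq : IsIntegral ℤ (z ^ 2 / q)) {M : ℤ} (hM : (M : K) = conjForm σ z) : (q : ℤ) ^ 2 ∣ M := by
  obtain ⟨e₁, e₂, e₃, D, h₁, h₂, h₃, hD⟩ := exists_int_symmetric h3 hσ hz
  obtain ⟨d1, d2, -⟩ := dvd_symmetric_of_isIntegral_sq_div hq hq2 hzq h₁ h₂ h₃ hD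
  rw [conjForm_eq h₁ h₂] at hM
  obtain rfl : M = e₁ ^ 2 - 3 * e₂ := by exact_mod_cast hM
  exact dvd_sub (pow_dvd_pow_of_dvd d1 2) (d2.mul_left 3)

/-- Here 9 ∣ M and 27 ∣ D make y = (σ z - z)/3 integral. The form at y equals M/3, so 9 ∣ M/3. -/
theorem IsConductor.twentySeven_dvd_conjForm (h3 : Module.finrank ℚ K = 3) (hp : IsConductor K p)
    {σ : K ≃ₐ[ℚ] K} (hσ : σ ≠ 1) (hqp : 3 ∣ p) {z : K} (hz : IsIntegral ℤ z)
    (hzq : IsIntegral ℤ (z ^ 2 / 3)) {M : ℤ} (hM : (M : K) = conjForm σ z) : 27 ∣ M := by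
  obtain ⟨e₁, e₂, e₃, D, h₁, h₂, h₃, hD⟩ := exists_int_symmetric h3 hσ hz
  obtain ⟨d1, d2, d3⟩ := dvd_symmetric_of_isIntegral_sq_div Nat.prime_three (by norm_num)
    (by exact_mod_cast hzq) h₁ h₂ h₃ hD
  obtain ⟨D', rfl⟩ := twentySeven_dvd_of_cubicDisc_eq_sq d1 d2 d3 (sq_eq_cubicDisc h₁ h₂ h₃ hD)
  obtain ⟨m, rfl⟩ := hp.nine_dvd_conjForm h3 hσ hqp hz hM
  have hs := apply_apply_apply_of_finrank_eq_three h3 σ z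
  have hy : IsIntegral ℤ ((σ z - z) / 3) := by
    -- The three differences of conjugates sum to 0 and are the roots of X³ - M X - D; dividing them
    -- by 3 turns M = 9 m and D = 27 D' into m and D'.
    refine ⟨Polynomial.X ^ 3 - (Polynomial.C m * Polynomial.X + Polynomial.C D'), ?_, ?_⟩
    · refine Polynomial.monic_X_pow_sub ?_
      exact (Polynomial.degree_linear_le).trans_lt (by norm_num)
    · simp only [Polynomial.eval₂_sub, Polynomial.eval₂_add, Polynomial.eval₂_mul,
        Polynomial.eval₂_pow, Polynomial.eval₂_X, Polynomial.eval₂_C]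
      rw [eq_intCast, eq_intCast]
      push_cast at hM hD
      rw [conjForm] at hM
      linear_combination (-(σ z - z) / 27) * hM - hD / 27
  have h9 : (9 : ℤ) ∣ 3 * m := by
    refine hp.nine_dvd_conjForm h3 hσ hqp hy ?_
    push_cast at hM ⊢
    rw [conjForm] at hM ⊢
    simp only [map_div₀, map_sub, map_ofNat, hs]
    linear_combination hM / 3
  omega

/-- The form `conjForm` takes values divisible by the conductor on integral elements, with an
additional factor `gcd(p, d)` if the element is suitably divisible. -/
theorem IsConductor.mul_gcd_dvd_conjForm (h3 : Module.finrank ℚ K = 3) (hp : IsConductor K p)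
    {σ : K ≃ₐ[ℚ] K} (hσ : σ ≠ 1) {z : K} (hz : IsIntegral ℤ z) {d : ℕ} (hd : Squarefree d)
    (hzd : IsIntegral ℤ ((d : K) * (z / (Nat.gcd p d : ℕ)) ^ 2)) :
    ∃ M : ℤ, (M : K) = conjForm σ z ∧ ((p * Nat.gcd p d : ℕ) : ℤ) ∣ M := by
  obtain ⟨e₁, e₂, e₃, D, h₁, h₂, h₃, hD⟩ := exists_int_symmetric h3 hσ hz
  have hM := (conjForm_eq h₁ h₂).symm
  generalize e₁ ^ 2 - 3 * e₂ = M at hM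
  refine ⟨M, hM, ?_⟩
  rw [Int.natCast_dvd, Nat.dvd_iff_prime_pow_dvd_dvd]
  intro q k hq hk
  rcases Nat.eq_zero_or_pos k with rfl | hk0
  · simp
  have hqp : q ∣ p := by
    rcases hq.dvd_mul.1 ((dvd_pow_self q hk0.ne').trans hk) with h | h
    · exact h
    · exact h.trans (Nat.gcd_dvd_left _ _)
  obtain ⟨hq2, hqsq, hq27⟩ := hp.shape_of_finrank_eq_three h3 hq hqp
  have hgd : Nat.gcd p d ∣ d := Nat.gcd_dvd_right _ _
  have hgq : ¬ q ^ 2 ∣ Nat.gcd p d := fun h =>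
    hq.one_lt.ne' (Nat.isUnit_iff.1 (hd q (by rw [← sq]; exact h.trans hgd)))
  -- The exponent of q in p gcd(p, d) is at most the sum of that in p (2 if q = 3, else 1) and that
  -- in gcd(p, d) (at most 1).
  suffices H : ∀ n, k ≤ n → (q : ℤ) ^ n ∣ M → q ^ k ∣ M.natAbs by
    by_cases hqg : q ∣ Nat.gcd p d
    · have hzq := isIntegral_sq_div_of_dvd hd hgd hq hqg hz hzd
      by_cases hq3 : q = 3
      · subst hq3
        refine H 3 (hq.le_of_pow_dvd_mul (i := 2) (j := 1) (hq27 rfl) hgq hk) ?_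
        exact hp.twentySeven_dvd_conjForm h3 hσ hqp hz (by exact_mod_cast hzq) hM
      · refine H 2 (hq.le_of_pow_dvd_mul (i := 1) (j := 1) (fun h => hq3 (hqsq h)) hgq hk) ?_
        exact sq_dvd_conjForm_of_isIntegral_sq_div h3 hσ hq hq2 hz hzq hM
    · have hqg' : ¬ q ^ (0 + 1) ∣ Nat.gcd p d := by simpa using hqg
      by_cases hq3 : q = 3
      · subst hq3
        refine H 2 (hq.le_of_pow_dvd_mul (i := 2) (j := 0) (hq27 rfl) hqg' hk) ?_
        exact hp.nine_dvd_conjForm h3 hσ hqp hz hM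
      · refine H 1 (hq.le_of_pow_dvd_mul (i := 1) (j := 0) (fun h => hq3 (hqsq h)) hqg' hk) ?_
        rw [pow_one]
        exact (hp.dvd_conjForm h3 hq hqp hz hM hD).1
  intro n hkn hn
  rw [← Int.natCast_dvd]
  push_cast
  exact (pow_dvd_pow _ hkn).trans hn

end CyclicCubicDivisibility

/-! ### Lower bounds for sums of squares of conjugates -/

section RealBounds

/-- The sum of the squares of the conjugates of `z`, through a real embedding. -/
noncomputable def traceSq {K : Type*} [Field K] (φ : K →+* ℝ) (σ : K → K) (z : K) : ℝ :=
  φ z ^ 2 + φ (σ z) ^ 2 + φ (σ (σ z)) ^ 2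

theorem traceSq_nonneg {K : Type*} [Field K] (φ : K →+* ℝ) (σ : K → K) (z : K) : 0 ≤ traceSq φ σ z := by
  unfold traceSq
  positivity

variable {K : Type*} [Field K] [NumberField K]

variable [IsGalois ℚ K] {p : ℕ}

theorem three_le_traceSq (h3 : Module.finrank ℚ K = 3) {σ : K ≃ₐ[ℚ] K} (hσ : σ ≠ 1)
    (φ : K →+* ℝ) {z : K} (hz : IsIntegral ℤ z) (hz0 : z ≠ 0) : 3 ≤ traceSq φ σ z := by
  obtain ⟨e₁, e₂, e₃, D, h₁, h₂, h₃, hD⟩ := exists_int_symmetric h3 hσ hz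
  have he : e₃ ≠ 0 := by
    rintro rfl
    simp [hz0] at h₃
  have he1 : (1 : ℝ) ≤ (e₃ : ℝ) ^ 2 := by
    have : (1 : ℤ) ≤ e₃ ^ 2 := by
      have := sq_pos_of_ne_zero he
      omega
    exact_mod_cast this
  have h : (e₃ : ℝ) = φ z * φ (σ z) * φ (σ (σ z)) := by
    rw [← map_mul, ← map_mul, ← h₃, map_intCast]
  rw [h, mul_pow, mul_pow] at he1
  unfold traceSq
  generalize φ z = a at *
  generalize φ (σ z) = b at *
  generalize φ (σ (σ z)) = c at *
  have hmean : 27 * (a ^ 2 * b ^ 2 * c ^ 2) ≤ (a ^ 2 + b ^ 2 + c ^ 2) ^ 3 := by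
    have ha := sq_nonneg a
    have hb := sq_nonneg b
    have hc := sq_nonneg c
    generalize a ^ 2 = x at *
    generalize b ^ 2 = y at *
    generalize c ^ 2 = w at *
    nlinarith [mul_nonneg ha (sq_nonneg (y - w)), mul_nonneg hb (sq_nonneg (x - w)),
      mul_nonneg hc (sq_nonneg (x - y)), mul_nonneg ha (sq_nonneg (x - y)),
      mul_nonneg ha (sq_nonneg (x - w)), mul_nonneg hb (sq_nonneg (y - x)),
      mul_nonneg hb (sq_nonneg (y - w)), mul_nonneg hc (sq_nonneg (w - x)),
      mul_nonneg hc (sq_nonneg (w - y))]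
  by_contra! hlt
  have : (a ^ 2 + b ^ 2 + c ^ 2) ^ 3 < 3 ^ 3 := pow_lt_pow_left₀ hlt (by positivity) (by norm_num)
  linarith

theorem IsConductor.le_traceSq (h3 : Module.finrank ℚ K = 3) (hp : IsConductor K p)
    {σ : K ≃ₐ[ℚ] K} (hσ : σ ≠ 1) (φ : K →+* ℝ) {z : K} (hz : IsIntegral ℤ z)
    (hzZ : ∀ n : ℤ, (n : K) ≠ z) {d : ℕ} (hd : Squarefree d)
    (hzd : IsIntegral ℤ ((d : K) * (z / (Nat.gcd p d : ℕ)) ^ 2)) :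
    2 * ((p : ℝ) * (Nat.gcd p d : ℕ)) ≤ 3 * traceSq φ σ z := by
  obtain ⟨M, hM, hdvd⟩ := hp.mul_gcd_dvd_conjForm h3 hσ hz hd hzd
  have hMφ := congrArg φ hM
  simp only [map_intCast, conjForm, map_sub, map_add, map_mul, map_pow] at hMφ
  have hMpos : 0 < M := by
    have hM0 : (0 : ℝ) ≤ M := by
      rw [hMφ]
      nlinarith [sq_nonneg (φ z - φ (σ z)), sq_nonneg (φ (σ z) - φ (σ (σ z))),
        sq_nonneg (φ (σ (σ z)) - φ z)]
    refine lt_of_le_of_ne (by exact_mod_cast hM0) ?_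
    rintro rfl
    have h0 : (φ (σ z) - φ z) ^ 2 = 0 := by
      refine le_antisymm ?_ (sq_nonneg _)
      push_cast at hMφ
      nlinarith [sq_nonneg (φ (σ z) - φ (σ (σ z))), sq_nonneg (φ (σ (σ z)) - φ z)]
    have h1 : σ z = z := φ.injective (sub_eq_zero.1 (pow_eq_zero_iff two_ne_zero |>.1 h0))
    obtain ⟨n, hn⟩ := exists_int_of_apply_eq h3 hσ hz h1
    exact hzZ n hn
  have hle : ((p : ℝ) * (Nat.gcd p d : ℕ)) ≤ M := by exact_mod_cast Int.le_of_dvd hMpos hdvd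
  unfold traceSq
  nlinarith [sq_nonneg (φ z + φ (σ z) + φ (σ (σ z)))]

theorem IsConductor.le_traceSq_of_isIntegral (h3 : Module.finrank ℚ K = 3) (hp : IsConductor K p)
    {σ : K ≃ₐ[ℚ] K} (hσ : σ ≠ 1) (φ : K →+* ℝ) {z : K} (hz : IsIntegral ℤ z)
    (hzZ : ∀ n : ℤ, (n : K) ≠ z) : 2 * (p : ℝ) ≤ 3 * traceSq φ σ z := by
  simpa using hp.le_traceSq h3 hσ φ hz hzZ squarefree_one (by simpa using hz.pow 2)

/-- The case of a non-rational second coordinate, in terms of the coordinates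
`γ = f + f̄` and `β = t (f - f̄) / √-d`. -/
theorem IsConductor.le_sixtyOne (h3 : Module.finrank ℚ K = 3) (hp : IsConductor K p)
    {σ : K ≃ₐ[ℚ] K} (hσ : σ ≠ 1) (φ : K →+* ℝ) {α β γ : K} {d : ℕ} (hd : Squarefree d)
    (hα : IsIntegral ℤ α) (hβ : IsIntegral ℤ β) (hγ : IsIntegral ℤ γ)
    (hγt : γ * (Nat.gcd p d : ℕ) = 2 * α + β)
    (hβd : IsIntegral ℤ ((d : K) * (β / (Nat.gcd p d : ℕ)) ^ 2))
    (hαd : γ = 0 → IsIntegral ℤ ((d : K) * (α / (Nat.gcd p d : ℕ)) ^ 2))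
    (hlen : traceSq φ σ γ + d / (Nat.gcd p d : ℕ) ^ 2 * traceSq φ σ β < 44)
    (hβZ : ∀ n : ℤ, (n : K) ≠ β) : p ≤ 61 ∧ d ≤ 61 := by
  have hp0 : 0 < p := hp.1.1
  have hd0 : 0 < d := Nat.pos_of_ne_zero hd.ne_zero
  have ht0 : 0 < Nat.gcd p d := Nat.gcd_pos_of_pos_left _ hp0
  obtain ⟨p', hp'⟩ : Nat.gcd p d ∣ p := Nat.gcd_dvd_left _ _
  obtain ⟨d', hd'⟩ : Nat.gcd p d ∣ d := Nat.gcd_dvd_right _ _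
  have hbound := fun z => hp.le_traceSq h3 hσ φ (z := z) (d := d)
  generalize Nat.gcd p d = t at *
  have htR : (0 : ℝ) < t := by exact_mod_cast ht0
  have hdR : (d : ℝ) = t * d' := by exact_mod_cast hd'
  have hpd : p ≤ p * d' := by
    rcases Nat.eq_zero_or_pos d' with rfl | h
    · omega
    · exact Nat.le_mul_of_pos_right _ h
  have hdd : d ≤ p * d' := by
    rcases Nat.eq_zero_or_pos p' with rfl | h
    · omega
    · calc d = t * d' * 1 := by rw [← hd', mul_one]
        _ ≤ t * d' * p' := Nat.mul_le_mul_left _ h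
        _ = p * d' := by rw [hp']; ring
  suffices H : p * d' ≤ 61 from ⟨hpd.trans H, hdd.trans H⟩
  have hscale : ∀ T : ℝ, 2 * ((p : ℝ) * t) ≤ 3 * T → 2 * ((p : ℝ) * d') ≤ 3 * (d / t ^ 2 * T) := by
    intro T hT
    have h1 : (0 : ℝ) ≤ d' / t := by positivity
    calc 2 * ((p : ℝ) * d') = d' / t * (2 * (p * t)) := by field_simp
      _ ≤ d' / t * (3 * T) := mul_le_mul_of_nonneg_left hT h1
      _ = _ := by rw [hdR]; field_simp
  -- If γ ≠ 0, T(γ) ≥ 3 leaves (2/3) p d' < 41. If γ = 0, then β = -2α and the bound applied to α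
  -- gives (8/3) p d' < 44.
  have hreal : (p : ℝ) * d' < 62 := by
    by_cases hγ0 : γ = 0
    · have hβα : β = -2 * α := by
        rw [hγ0, zero_mul] at hγt
        linear_combination -hγt
      have hαZ : ∀ n : ℤ, (n : K) ≠ α := fun n hn =>
        hβZ (-2 * n) (by push_cast; rw [hn, hβα])
      have hT : traceSq φ σ β = 4 * traceSq φ σ α := by
        rw [hβα]
        simp only [traceSq, map_mul, map_neg, map_ofNat]
        ring
      have h1 := hscale _ (hbound α hα hαZ hd (hαd hγ0))
      have h2 := traceSq_nonneg φ σ γ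
      rw [hT] at hlen
      linarith
    · have h1 := hscale _ (hbound β hβ hβZ hd hβd)
      have h2 := three_le_traceSq h3 hσ φ hγ hγ0
      linarith
  have : p * d' < 62 := by exact_mod_cast hreal
  omega

/-- The case of a rational second coordinate. -/
theorem IsConductor.le_of_intCast (h3 : Module.finrank ℚ K = 3) (hp : IsConductor K p)
    {σ : K ≃ₐ[ℚ] K} (hσ : σ ≠ 1) (φ : K →+* ℝ) {γ : K} {b : ℤ} {d : ℕ} (hd : Squarefree d)
    (hγ : IsIntegral ℤ γ) (hb : b ≠ 0)
    (hβd : IsIntegral ℤ ((d : K) * ((b : K) / (Nat.gcd p d : ℕ)) ^ 2))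
    (hlen : traceSq φ σ γ + d / (Nat.gcd p d : ℕ) ^ 2 * traceSq φ σ (b : K) < 44)
    (hγZ : ∀ n : ℤ, (n : K) ≠ γ) : p ≤ 61 ∧ d < 15 := by
  have hp0 : 0 < p := hp.1.1
  have ht0 : 0 < Nat.gcd p d := Nat.gcd_pos_of_pos_left _ hp0
  have hd1 : (1 : ℝ) ≤ d := by exact_mod_cast Nat.pos_of_ne_zero hd.ne_zero
  have hpγ := hp.le_traceSq_of_isIntegral h3 hσ φ hγ hγZ
  obtain ⟨d', hd'⟩ : Nat.gcd p d ∣ d := Nat.gcd_dvd_right _ _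
  generalize Nat.gcd p d = t at *
  have htR : (0 : ℝ) < t := by exact_mod_cast ht0
  have htK : (t : K) ≠ 0 := by exact_mod_cast ht0.ne'
  have htb : (t : ℤ) ∣ b := by
    have h1 : (t : ℤ) ∣ d' * b ^ 2 := by
      refine Int.dvd_of_isIntegral_div (K := K) (by exact_mod_cast ht0.ne') (hβd.of_eq ?_)
      rw [hd']
      push_cast
      field_simp
    have h2 : IsCoprime (t : ℤ) d' := by
      rw [Nat.isCoprime_iff_coprime]
      exact Nat.coprime_of_squarefree_mul (hd' ▸ hd)
    have h3 := h2.dvd_of_dvd_mul_left h1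
    have h4 : Squarefree t := hd.squarefree_of_dvd ⟨d', hd'⟩
    exact ((Int.squarefree_natCast.2 h4).dvd_pow_iff_dvd two_ne_zero).1 h3
  have hbt : (t : ℝ) ^ 2 ≤ (b : ℝ) ^ 2 := by
    have : (t : ℤ) ^ 2 ≤ b ^ 2 := Int.le_of_dvd (by positivity) (pow_dvd_pow_of_dvd htb 2)
    exact_mod_cast this
  have hT : 3 * (d : ℝ) ≤ d / t ^ 2 * traceSq φ σ (b : K) := by
    simp only [traceSq, map_intCast]
    calc 3 * (d : ℝ) = d / t ^ 2 * (3 * t ^ 2) := by field_simp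
      _ ≤ d / t ^ 2 * (3 * b ^ 2) := by gcongr
      _ = _ := by ring
  have hγ0 := traceSq_nonneg φ σ γ
  constructor
  -- Since d ≥ 1, the second term is at least 3, so T(γ) < 41.
  · have : (p : ℝ) < 62 := by linarith
    have : p < 62 := by exact_mod_cast this
    omega
  · have : (d : ℝ) < 15 := by linarith
    exact_mod_cast this

end RealBounds

/-! ### Coordinates in the sextic field and the final bounds -/

section Sextic

variable {F : Type*} [Field F] [NumberField F]

/-- The squared length in terms of coordinates with respect to `1, √-d` over the real subfield. -/
theorem lengthSq_eq_traceSq {ι : F →+* ℂ} {τ : F ≃ₐ[ℚ] F} {K : Subfield F} {σ : K → K}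
    (hσ : ∀ x : K, (σ x : F) = τ x) {φ : K →+* ℝ} (hφ : ∀ x : K, (φ x : ℂ) = ι x)
    {d t : ℕ} {s : F} (hs : s ^ 2 = -(d : F)) (hsι : starRingEnd ℂ (ι s) = -ι s)
    {γ β : K} {f : F} (hf : f = (γ + s * β / t) / 2) :
    2 * lengthSq ι τ f = traceSq φ σ γ + d / t ^ 2 * traceSq φ σ β := by
  have hιs : ι s ^ 2 = -(d : ℂ) := by rw [← map_pow, hs]; simp
  -- Since τ s = ±s and the sign of ε does not affect the norm, this covers all three conjugates of
  -- f.
  have key : ∀ (g b : K) (ε : F), (ε = s ∨ ε = -s) →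
      4 * ‖ι (((g : F) + ε * b / t) / 2)‖ ^ 2 = φ g ^ 2 + d / t ^ 2 * φ b ^ 2 := by
    intro g b ε hε
    have hconj : starRingEnd ℂ (ι ε) = -ι ε ∧ ι ε ^ 2 = -(d : ℂ) := by
      rcases hε with rfl | rfl
      · exact ⟨hsι, hιs⟩
      · constructor
        · rw [map_neg, map_neg, hsι]
        · rw [map_neg, neg_sq, hιs]
    have : ((4 * ‖ι (((g : F) + ε * b / t) / 2)‖ ^ 2 : ℝ) : ℂ) =
        ((φ g ^ 2 + d / t ^ 2 * φ b ^ 2 : ℝ) : ℂ) := by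
      push_cast
      rw [← Complex.mul_conj']
      simp only [map_div₀, map_add, map_mul, map_natCast, map_ofNat, ← hφ, Complex.conj_ofReal,
        hconj.1]
      linear_combination (-(φ b : ℂ) ^ 2 / t ^ 2) * hconj.2
    exact_mod_cast this
  have hτs : τ s = s ∨ τ s = -s := by
    rw [← sq_eq_sq_iff_eq_or_eq_neg, ← map_pow, hs]
    simp
  have hτapply : ∀ (g b : K) (ε : F), τ (((g : F) + ε * b / t) / 2) =
      ((σ g : F) + τ ε * σ b / t) / 2 := by
    intro g b ε
    simp [hσ, map_ofNat]
  have hττs : τ (τ s) = s := by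
    rcases hτs with h | h
    · rw [h, h]
    · rw [h, map_neg, h, neg_neg]
  have h0 := key γ β s (Or.inl rfl)
  have h1 := key (σ γ) (σ β) (τ s) hτs
  have h2 := key (σ (σ γ)) (σ (σ β)) s (Or.inl rfl)
  have e0 : (τ ^ 0) f = ((γ : F) + s * β / t) / 2 := by simp [hf]
  have e1 : (τ ^ 1) f = ((σ γ : F) + τ s * σ β / t) / 2 := by rw [pow_one, hf, hτapply]
  have e2 : (τ ^ 2) f = ((σ (σ γ) : F) + s * σ (σ β) / t) / 2 := by
    rw [sq, AlgEquiv.mul_apply, hf, hτapply, hτapply, hττs]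
  rw [lengthSq, Finset.sum_range_succ, Finset.sum_range_succ, Finset.sum_range_one, e0, e1, e2]
  unfold traceSq
  linear_combination h0 + h1 + h2

end Sextic

theorem proposition3p3 {F : Type*} [Field F] [NumberField F] [IsGalois ℚ F]
    [IsTotallyComplex F] (hF : Module.finrank ℚ F = 6)
    (ι : F →+* ℂ) (τ : F ≃ₐ[ℚ] F) (hτ : ∀ g : F ≃ₐ[ℚ] F, g ∈ Subgroup.zpowers τ)
    (p : ℕ) (hp : IsConductor (maximalRealSubfield F) p)
    (d : ℕ) (hd : Squarefree d) (hd3 : d % 4 = 3)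
    (s : F) (hs : s ^ 2 = -(d : F))
    (δ : F) (hδ : δ = (1 + s) / 2)
    (t : ℕ) (ht : t = Nat.gcd p d)
    (α β f : F)
    (hα : α ∈ integersOf (maximalRealSubfield F))
    (hβ : β ∈ integersOf (maximalRealSubfield F))
    (hf : f = (α + β * δ) / (t : F))
    (hfF : IsIntegral ℤ f)
    (hfn : f ∉ integersOf (maximalRealSubfield F) ∪ integersOf (ℚ⟮s⟯).toSubfield ∪
      rootsOfUnityOf F)
    (hlen : lengthSq ι τ f < 22) :
    ((β ∉ Set.range (fun b : ℤ => (b : F))) → p ≤ 61 ∧ d ≤ 59) ∧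
    ((β ∈ Set.range (fun b : ℤ => (b : F)) ∧ β ≠ 0) → p ≤ 61 ∧ d ≤ 11) := by
  subst ht
  have : IsCyclic (F ≃ₐ[ℚ] F) := ⟨⟨τ, hτ⟩⟩
  have : IsAbelianGalois ℚ F := IsAbelianGalois.of_isCyclic ℚ F
  have hab : IsAbelianGalois ℚ (maximalRealSubfield F) :=
    IsAbelianGalois.tower_bot ℚ (maximalRealSubfield F) F
  have h3 : Module.finrank ℚ (maximalRealSubfield F) = 3 := by
    have h1 := Module.finrank_mul_finrank ℚ (maximalRealSubfield F) F
    rw [Algebra.IsQuadraticExtension.finrank_eq_two (maximalRealSubfield F) F, hF] at h1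
    omega
  set σ : maximalRealSubfield F ≃ₐ[ℚ] maximalRealSubfield F :=
    τ.restrictNormal (maximalRealSubfield F)
  have hστ : ∀ x : maximalRealSubfield F, (σ x : F) = τ x := fun x =>
    τ.restrictNormal_commutes (maximalRealSubfield F) x
  have hσ1 : σ ≠ 1 := by
    intro h
    have hcard : Nat.card (maximalRealSubfield F ≃ₐ[ℚ] maximalRealSubfield F) = 3 := by
      rw [IsGalois.card_aut_eq_finrank, h3]
    have htriv : ∀ g : maximalRealSubfield F ≃ₐ[ℚ] maximalRealSubfield F, g = 1 := by
      intro g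
      obtain ⟨g', rfl⟩ := AlgEquiv.restrictNormalHom_surjective (F := ℚ)
        (K₁ := maximalRealSubfield F) F g
      obtain ⟨n, rfl⟩ := hτ g'
      have : AlgEquiv.restrictNormalHom (maximalRealSubfield F) τ = 1 := h
      simp [this]
    have : Subsingleton (maximalRealSubfield F ≃ₐ[ℚ] maximalRealSubfield F) :=
      ⟨fun a b => by rw [htriv a, htriv b]⟩
    rw [Nat.card_of_subsingleton 1] at hcard
    omega
  have hreal : ComplexEmbedding.IsReal (ι.comp (algebraMap (maximalRealSubfield F) F)) := by
    rw [ComplexEmbedding.isReal_iff]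
    ext x
    exact x.2 ι
  set φ := hreal.embedding
  have hφ : ∀ x : maximalRealSubfield F, (φ x : ℂ) = ι x := fun x => hreal.coe_embedding_apply x
  have hιs : ι s ^ 2 = -(d : ℂ) := by rw [← map_pow, hs]; simp
  have hd0 : (0 : ℝ) < d := by exact_mod_cast Nat.pos_of_ne_zero hd.ne_zero
  have hsι : starRingEnd ℂ (ι s) = -ι s := by
    have h1 : (ι s).re * (ι s).im = 0 := by
      have := congrArg Complex.im hιs
      simp [sq] at this
      linarith
    have h2 : (ι s).re ^ 2 - (ι s).im ^ 2 = -d := by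
      have := congrArg Complex.re hιs
      simp [sq] at this
      linarith
    have h4 : (ι s).re = 0 := by
      rcases mul_eq_zero.1 h1 with h | h
      · exact h
      · rw [h] at h2
        nlinarith [sq_nonneg (ι s).re]
    apply Complex.ext <;> simp [h4]
  set c := IsCMField.complexConj F
  have hcι : ∀ x, ι (c x) = starRingEnd ℂ (ι x) := fun x =>
    IsCMField.complexEmbedding_complexConj F ι x
  have hcs : c s = -s := ι.injective (by rw [hcι, hsι, map_neg])
  have hcK : ∀ x : maximalRealSubfield F, c x = x := fun x => c.commutes x
  obtain ⟨⟨hαK, hαi⟩, ⟨hβK, hβi⟩⟩ := And.intro hα hβ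
  have hint : ∀ x : maximalRealSubfield F, IsIntegral ℤ (x : F) → IsIntegral ℤ x := fun x hx =>
    (isIntegral_algebraMap_iff (algebraMap (maximalRealSubfield F) F).injective).1 hx
  lift α to maximalRealSubfield F using hαK
  lift β to maximalRealSubfield F using hβK
  have ht0 : Nat.gcd p d ≠ 0 := (Nat.gcd_pos_of_pos_left _ hp.1.1).ne'
  have htF : ((Nat.gcd p d : ℕ) : F) ≠ 0 := by exact_mod_cast ht0
  set γ : maximalRealSubfield F := (2 * α + β) / (Nat.gcd p d : ℕ) with hγdef
  have hγF : (γ : F) = (2 * α + β) / (Nat.gcd p d : ℕ) := by rw [hγdef]; push_cast; rfl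
  have hfγ : f = ((γ : F) + s * β / (Nat.gcd p d : ℕ)) / 2 := by
    rw [hf, hδ, hγF]
    field_simp
    ring
  have hcf : c f = ((γ : F) - s * β / (Nat.gcd p d : ℕ)) / 2 := by
    rw [hfγ]
    simp only [map_div₀, map_add, map_mul, map_natCast, map_ofNat, hcs, hcK]
    ring
  have hcfi : IsIntegral ℤ (c f) := hfF.map (c : F →+* F).toIntAlgHom
  have hγi : IsIntegral ℤ γ := hint _ ((hfF.add hcfi).of_eq (by rw [hcf, hfγ]; ring))
  -- The element is -(f - f̄)².
  have hβd : IsIntegral ℤ ((d : maximalRealSubfield F) * (β / (Nat.gcd p d : ℕ)) ^ 2) := by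
    refine hint _ (((hfF.sub hcfi).pow 2).neg.of_eq ?_)
    rw [hcf, hfγ]
    push_cast
    linear_combination ((β : F) / (Nat.gcd p d : ℕ)) ^ 2 * hs
  -- For γ = 0, f = -α s/t, so the element is -f².
  have hαd : γ = 0 → IsIntegral ℤ ((d : maximalRealSubfield F) * (α / (Nat.gcd p d : ℕ)) ^ 2) := by
    intro h0
    have hγ0 : (2 * (α : F) + β) / (Nat.gcd p d : ℕ) = 0 := by rw [← hγF, h0]; rfl
    have hβα : (β : F) = -2 * α := by
      rw [div_eq_zero_iff, or_iff_left htF] at hγ0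
      linear_combination hγ0
    refine hint _ ((hfF.pow 2).neg.of_eq ?_)
    rw [hf, hδ, hβα]
    push_cast
    linear_combination ((α : F) / (Nat.gcd p d : ℕ)) ^ 2 * hs
  have hlen' : traceSq φ σ γ + d / (Nat.gcd p d : ℕ) ^ 2 * traceSq φ σ β < 44 := by
    rw [← lengthSq_eq_traceSq hστ hφ hs hsι hfγ]
    linarith
  constructor
  · intro hβZ
    have := hp.le_sixtyOne h3 hσ1 φ hd (hint α hαi) (hint β hβi) hγi
      (div_mul_cancel₀ _ (by exact_mod_cast ht0)) hβd hαd hlen'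
      (fun n hn => hβZ ⟨n, by rw [← hn]; simp⟩)
    -- Neither 60 nor 61 is 3 modulo 4, so d ≤ 61 drops to 59.
    omega
  · rintro ⟨⟨b, hb⟩, hβ0⟩
    obtain rfl : (b : maximalRealSubfield F) = β := Subtype.ext (by simpa using hb)
    have := hp.le_of_intCast h3 hσ1 φ hd hγi (by rintro rfl; simp at hβ0) hβd hlen' ?_
    · omega
    · intro n hn
      -- If γ were rational as well as β, f would lie in O_k.
      refine hfn (Or.inl (Or.inr ⟨?_, hfF⟩))
      rw [hfγ, ← hn]
      change _ ∈ ℚ⟮s⟯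
      have hsmem : s ∈ ℚ⟮s⟯ := mem_adjoin_simple_self ℚ s
      refine div_mem (add_mem ?_ (div_mem (mul_mem hsmem ?_) (_root_.natCast_mem _ _))) (ofNat_mem _ 2)
      · simp
      · simp
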